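/- All graphs are finite and simple. For integers $\ell,m\ge 1$ let $R(\ell,m)$ be the Ramsey number, that is, the least $n$ such that every graph on $n$ vertices contains a clique $K_\ell$ or an independent set of size $m$. For $t\ge 2$ let $Q(t,n)$ be the minimum independence number of a $K_t$-free graph on $n$ vertices. For a graph $H$ and a function $f$, let $\mathrm{RT}(n,H,f(n))$ be the maximum number of edges of an $H$-free graph on $n$ vertices with independence number (strictly) less than $f(n)$, taken to be $0$ if there is no such graph. We write $\mathrm{RT}(H,f)=c$ if $$\limsup_{n\to\infty}\frac{\mathrm{RT}(n,H,f(n))}{n^2}=\liminf_{n\to\infty}\frac{\mathrm{RT}(n,H,f(n))}{n^2}=c .$$ **Theorem.** Let $s\ge t\ge 2$ be integers and let $r=\left\lfloor\frac{s-1}{t-1}\right\rfloor$. Suppose that there are $\vartheta>0$ and $N>0$ such that $$R(t-1,n)\le \frac{R(t,n)}{n^{\vartheta}}\qquad\text{for all integers } n>N .$$ Then, for the function $f(n)=Q(t,n)$, the Ramsey-Turán density $\mathrm{RT}(K_s,f)$ exists and $$\mathrm{RT}\bigl(K_s,Q(t,n)\bigr)=\frac12\left(1-\frac1r\right).$$ 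-/

import Mathlib

open Filter

noncomputable section

namespace RamseyTuran

/-- The Ramsey number `R(ℓ, m)`: the least `n` such that every graph on `n` vertices contains
a clique on `ℓ` vertices or an independent set of size `m`. -/
def ramseyNumber (ℓ m : ℕ) : ℕ :=
  sInf {n : ℕ | ∀ G : SimpleGraph (Fin n),
    ¬ G.CliqueFree ℓ ∨ ∃ S : Finset (Fin n), G.IsNIndepSet m S}

/-- The inverse Ramsey function `Q(t, n)`: the minimum independence number of the `K_t`-free
graphs on `n` vertices. -/
def inverseRamsey (t n : ℕ) : ℕ :=
  sInf {a : ℕ | ∃ G : SimpleGraph (Fin n), G.CliqueFree t ∧ G.indepNum = a}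

/-- The Ramsey-Turán function `RT(n, H, x)`: the maximum number of edges of an `H`-free graph on
`n` vertices with independence number less than `x` (the value is `0` if there is no such
graph). -/
def rtNumber {V : Type*} (n : ℕ) (H : SimpleGraph V) (x : ℝ) : ℕ :=
  sSup {e : ℕ | ∃ G : SimpleGraph (Fin n),
    H.Free G ∧ (G.indepNum : ℝ) < x ∧ G.edgeSet.ncard = e}

/-- The upper Ramsey-Turán density of `H` with respect to `f`. -/
def upperRTDensity {V : Type*} (H : SimpleGraph V) (f : ℕ → ℝ) : ℝ :=
  limsup (fun n : ℕ => (rtNumber n H (f n) : ℝ) / (n : ℝ) ^ 2) atTop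

/-- The lower Ramsey-Turán density of `H` with respect to `f`. -/
def lowerRTDensity {V : Type*} (H : SimpleGraph V) (f : ℕ → ℝ) : ℝ :=
  liminf (fun n : ℕ => (rtNumber n H (f n) : ℝ) / (n : ℝ) ^ 2) atTop

/-- `RT(H, f)` exists and equals `c`: the upper and the lower density both equal `c`. -/
def HasRTDensity {V : Type*} (H : SimpleGraph V) (f : ℕ → ℝ) (c : ℝ) : Prop :=
  upperRTDensity H f = c ∧ lowerRTDensity H f = c

/-- The polynomial gap between consecutive Ramsey numbers, for a fixed `ℓ`: for some `ϑ > 0`,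
`R(ℓ - 1, n) ≤ R(ℓ, n) / n ^ ϑ` for all sufficiently large `n`. -/
def RamseyGap (ℓ : ℕ) : Prop :=
  ∃ ϑ : ℝ, 0 < ϑ ∧ ∃ N : ℕ, ∀ n : ℕ, N < n →
    (ramseyNumber (ℓ - 1) n : ℝ) ≤ (ramseyNumber ℓ n : ℝ) / (n : ℝ) ^ ϑ

end RamseyTuran

end

namespace RamseyTuran

open Finset SimpleGraph

/-! Write Q = Q(t, n) and h = t - 1; the choice of r means r h < s ≤ (r + 1) h.

Upper bound. Since R(t, Q) ≤ n and Q is at least a fixed power of n, the gap gives R(t - 1, Q) ≤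
n^(1 - δ). So in a graph with independence number below Q every set of n^(1 - δ) vertices contains
K_h. With more than (1 - 1/r + ε) n²/2 edges, the graph has a linear-sized subgraph of relative
minimum degree above 1 - 1/r, hence Ω(n^(r + 1)) ordered cliques K_(r + 1). Dependent random choice
(`exists_isNClique_of_cliqueTuples`) replaces the vertices of such a clique, one at a time, by
copies of K_h, which yields K_((r + 1) h) and so K_s.

Lower bound. For r ≥ 2, join completely r copies of an optimal K_t-free graph on about n/r vertices:
cliques have at most r h < s vertices, and independent sets lie in one copy. The strict inequality
Q(t, n/r + 1) < Q(t, n) again comes from the gap (`RamseyGap.eventually_inverseRamsey_lt`). -/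

/-! ### Ramsey numbers and their inverse -/

/-- Every graph on `n` vertices contains a clique of size `ℓ` or an independent set of size `m`. -/
def IsRamsey (ℓ m n : ℕ) : Prop :=
  ∀ G : SimpleGraph (Fin n), ¬ G.CliqueFree ℓ ∨ ∃ S : Finset (Fin n), G.IsNIndepSet m S

lemma IsRamsey.exists_subset {ℓ m n : ℕ} (h : IsRamsey ℓ m n) {V : Type*} (G : SimpleGraph V)
    (W : Finset V) (hW : n ≤ #W) :
    (∃ S ⊆ W, G.IsNClique ℓ S) ∨ ∃ S ⊆ W, G.IsNIndepSet m S := by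
  obtain ⟨W', hW'W, hc⟩ := Finset.exists_subset_card_eq hW
  let f : Fin n ↪ V :=
    (W'.equivFinOfCardEq hc).symm.toEmbedding.trans (Function.Embedding.subtype _)
  have hf : ∀ S : Finset (Fin n), S.map f ⊆ W := by
    intro S x hx
    obtain ⟨i, -, rfl⟩ := Finset.mem_map.1 hx
    exact hW'W ((W'.equivFinOfCardEq hc).symm i).2
  rcases h (G.comap f) with h1 | ⟨S, hS⟩
  · simp only [CliqueFree, not_forall, not_not] at h1
    obtain ⟨S, hS⟩ := h1
    exact Or.inl ⟨S.map f, hf S, (hS.map (f := f)).mono (map_comap_le f G)⟩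
  · refine Or.inr ⟨S.map f, hf S, ?_, by simpa using hS.card_eq⟩
    intro x hx y hy hxy
    obtain ⟨i, hi, rfl⟩ := Finset.mem_map.1 (Finset.mem_coe.1 hx)
    obtain ⟨j, hj, rfl⟩ := Finset.mem_map.1 (Finset.mem_coe.1 hy)
    exact hS.isIndepSet hi hj (fun e => hxy (by rw [e]))

lemma IsRamsey.mono {ℓ m n n' : ℕ} (h : IsRamsey ℓ m n) (hn : n ≤ n') : IsRamsey ℓ m n' := by
  intro G
  rcases h.exists_subset G univ (by simpa using hn) with ⟨S, -, hS⟩ | ⟨S, -, hS⟩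
  · exact Or.inl fun hG => hG S hS
  · exact Or.inr ⟨S, hS⟩

/-- Erdős–Szekeres recursion: a vertex `v` has at least `a` non-neighbours or at least `b`
neighbours, and `v` extends the set found there. -/
lemma IsRamsey.succ_succ {ℓ m a b : ℕ} (ha : IsRamsey (ℓ + 1) m a) (hb : IsRamsey ℓ (m + 1) b)
    (hab : 0 < a + b) : IsRamsey (ℓ + 1) (m + 1) (a + b) := by
  classical
  intro G
  let v : Fin (a + b) := ⟨0, hab⟩
  let A : Finset (Fin (a + b)) := {w | w ≠ v ∧ ¬ G.Adj v w}
  let B : Finset (Fin (a + b)) := {w | G.Adj v w}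
  have hcard : a + b ≤ #A + #B + 1 := by
    have hsub : (univ : Finset (Fin (a + b))) ⊆ A ∪ B ∪ {v} := by
      intro w _
      by_cases h1 : w = v
      · simp [h1]
      · by_cases h2 : G.Adj v w <;> simp [A, B, h1, h2]
    calc a + b = #(univ : Finset (Fin (a + b))) := by simp
      _ ≤ #(A ∪ B ∪ {v}) := card_le_card hsub
      _ ≤ #(A ∪ B) + 1 := by simpa using card_union_le (A ∪ B) {v}
      _ ≤ #A + #B + 1 := by gcongr; exact card_union_le A B
  by_cases hA : a ≤ #A
  · rcases ha.exists_subset G A hA with ⟨S, -, hS⟩ | ⟨S, hSA, hS⟩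
    · exact Or.inl fun hG => hG S hS
    · refine Or.inr ⟨insert v S, ?_⟩
      rw [← isNClique_compl] at hS ⊢
      refine hS.insert fun w hw => ?_
      have := hSA hw
      simp only [A, mem_filter, mem_univ, true_and] at this
      exact (compl_adj _ _ _).2 ⟨this.1.symm, this.2⟩
  · rcases hb.exists_subset G B (by omega) with ⟨S, hSB, hS⟩ | ⟨S, -, hS⟩
    · refine Or.inl fun hG => hG (insert v S) (hS.insert fun w hw => ?_)
      simpa [B] using hSB hw
    · exact Or.inr ⟨S, hS⟩

/-- A polynomial upper bound for Ramsey numbers with a fixed clique size. -/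
lemma isRamsey_pow (ℓ m : ℕ) : IsRamsey (ℓ + 1) m (m ^ ℓ) := by
  have hm0 : ∀ ℓ n, IsRamsey ℓ 0 n := fun ℓ n G => Or.inr ⟨∅, by simp [isNIndepSet_iff]⟩
  induction ℓ generalizing m with
  | zero =>
    intro G
    exact Or.inl fun hG => hG {⟨0, by simp⟩} 
      ⟨by rw [coe_singleton]; exact Set.pairwise_singleton _ _, card_singleton _⟩
  | succ ℓ ih =>
    induction m with
    | zero => exact hm0 _ _
    | succ m ihm =>
      refine (ihm.succ_succ (ih (m + 1)) (by positivity)).mono ?_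
      calc m ^ (ℓ + 1) + (m + 1) ^ ℓ ≤ (m + 1) ^ ℓ * m + (m + 1) ^ ℓ := by
            rw [pow_succ]; gcongr; omega
        _ = (m + 1) ^ (ℓ + 1) := by ring

lemma isRamsey_ramseyNumber {ℓ : ℕ} (hℓ : 0 < ℓ) (m : ℕ) : IsRamsey ℓ m (ramseyNumber ℓ m) := by
  obtain ⟨ℓ, rfl⟩ := Nat.exists_eq_add_one.2 hℓ
  exact Nat.sInf_mem (s := {n | IsRamsey (ℓ + 1) m n}) ⟨_, isRamsey_pow ℓ m⟩

lemma ramseyNumber_le {ℓ m n : ℕ} (h : IsRamsey ℓ m n) : ramseyNumber ℓ m ≤ n :=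
  Nat.sInf_le h

lemma ramseyNumber_succ_succ_le {ℓ : ℕ} (hℓ : 0 < ℓ) (m : ℕ) :
    ramseyNumber (ℓ + 1) (m + 1) ≤ ramseyNumber (ℓ + 1) m + ramseyNumber ℓ (m + 1) := by
  -- A zero sum would force `ramseyNumber ℓ (m + 1) = 0`, which the graph without vertices refutes.
  refine ramseyNumber_le ((isRamsey_ramseyNumber ℓ.succ_pos m).succ_succ
    (isRamsey_ramseyNumber hℓ _) (Nat.pos_of_ne_zero fun h0 => ?_))
  have h := isRamsey_ramseyNumber hℓ (m + 1)
  rw [show ramseyNumber ℓ (m + 1) = 0 by omega] at h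
  rcases h ⊥ with h | ⟨S, hS⟩
  · refine h fun S hS => ?_
    have := hS.card_eq
    rw [Finset.eq_empty_of_isEmpty S] at this
    simp at this; omega
  · have := hS.card_eq
    rw [Finset.eq_empty_of_isEmpty S] at this
    simp at this

lemma exists_graph_inverseRamsey {t : ℕ} (ht : 2 ≤ t) (n : ℕ) :
    ∃ G : SimpleGraph (Fin n), G.CliqueFree t ∧ G.indepNum = inverseRamsey t n :=
  Nat.sInf_mem (s := {a : ℕ | ∃ G : SimpleGraph (Fin n), G.CliqueFree t ∧ G.indepNum = a})
    ⟨_, ⊥, cliqueFree_bot ht, rfl⟩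

lemma inverseRamsey_le {t n : ℕ} (G : SimpleGraph (Fin n)) (hG : G.CliqueFree t) :
    inverseRamsey t n ≤ G.indepNum :=
  Nat.sInf_le ⟨G, hG, rfl⟩

/-- `R(t, Q(t, n)) ≤ n`. -/
lemma ramseyNumber_inverseRamsey_le (t n : ℕ) : ramseyNumber t (inverseRamsey t n) ≤ n := by
  refine ramseyNumber_le fun G => ?_
  by_contra! h
  obtain ⟨hG, hS⟩ := h
  have h1 := inverseRamsey_le G hG
  obtain ⟨S, hS'⟩ := G.exists_isNIndepSet_indepNum
  obtain ⟨T, hTS, hT⟩ := Finset.exists_subset_card_eq (h1.trans hS'.card_eq.ge)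
  exact hS T ⟨hS'.isIndepSet.mono (by exact_mod_cast hTS), hT⟩

lemma le_inverseRamsey {t m n : ℕ} (ht : 2 ≤ t) (h : ramseyNumber t m ≤ n) :
    m ≤ inverseRamsey t n := by
  obtain ⟨G, hG, ha⟩ := exists_graph_inverseRamsey ht n
  rcases (isRamsey_ramseyNumber (by omega) m).mono h G with h1 | ⟨S, hS⟩
  · exact absurd hG h1
  · rw [← ha, ← hS.card_eq]
    exact hS.isIndepSet.card_le_indepNum

/-- A polynomial lower bound for the inverse Ramsey function. -/
lemma lt_inverseRamsey_succ_pow {t : ℕ} (ht : 2 ≤ t) (n : ℕ) :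
    n < (inverseRamsey t n + 1) ^ (t - 1) := by
  by_contra! h
  have h1 : ramseyNumber t (inverseRamsey t n + 1) ≤ n := by
    refine ramseyNumber_le (IsRamsey.mono ?_ h)
    obtain ⟨u, rfl⟩ : ∃ u, t = u + 1 := ⟨t - 1, by omega⟩
    exact isRamsey_pow u _
  have := le_inverseRamsey ht h1
  omega

/-! ### Dependent random choice -/

/-- **Dependent random choice** for a relation between two finite types. -/
lemma dependent_random_choice {V B : Type*} [Fintype V] [Fintype B] [DecidableEq V]
    (P : V → B → Prop) [∀ v b, Decidable (P v b)] {h d : ℕ} (hh : 0 < h) {p β M : ℝ}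
    (hp : 0 ≤ p) (hβ : 0 ≤ β) (hV : 0 < Fintype.card V) (hB : 0 < Fintype.card B)
    (hE : p * Fintype.card V * Fintype.card B ≤ ∑ v, (#{b | P v b} : ℝ))
    (hM : M ≤ Fintype.card V * p ^ d - (Fintype.card V : ℝ) ^ h * β ^ d) :
    ∃ U : Finset V, M ≤ #U ∧ ∀ S ⊆ U, #S = h →
      β * Fintype.card B ≤ #{b | ∀ v ∈ S, P v b} := by
  classical
  set n : ℝ := (Fintype.card V : ℝ) with hn
  set N : ℝ := (Fintype.card B : ℝ) with hN
  have hn0 : 0 < n := by rw [hn]; exact_mod_cast hV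
  have hN0 : 0 < N := by rw [hN]; exact_mod_cast hB
  -- For `d` uniformly random elements of `B`, let `X` be the set of vertices related to all of
  -- them. By convexity `X` has expected size at least n p^d, and it contains at most n^h β^d bad
  -- sets on average.
  let bad : Finset (Finset V) :=
    {S ∈ powersetCard h univ | (#{b | ∀ v ∈ S, P v b} : ℝ) < β * N}
  let X : (Fin d → B) → Finset V := fun x => {v | ∀ i, P v (x i)}
  have hcount : ∀ Q : B → Prop, ∀ [DecidablePred Q],
      #{x : Fin d → B | ∀ i, Q (x i)} = #{b | Q b} ^ d := by
    intro Q _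
    have : ({x : Fin d → B | ∀ i, Q (x i)} : Finset (Fin d → B))
        = Fintype.piFinset fun _ => ({b | Q b} : Finset B) := by
      ext x; simp [Fintype.mem_piFinset]
    rw [this, Fintype.card_piFinset]; simp
  have h1 : n * p ^ d * N ^ d ≤ ∑ x, (#(X x) : ℝ) := by
    have e1 : ∑ x, (#(X x) : ℝ) = ∑ v, (#{b | P v b} : ℝ) ^ d := by
      have := sum_card_bipartiteAbove_eq_sum_card_bipartiteBelow
        (s := (univ : Finset V)) (t := (univ : Finset (Fin d → B)))
        (fun v x => ∀ i, P v (x i))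
      simp only [bipartiteAbove, bipartiteBelow] at this
      rw [← Nat.cast_sum, ← this, Nat.cast_sum]
      refine sum_congr rfl fun v _ => ?_
      rw [hcount (fun b => P v b)]; push_cast; rfl
    rw [e1]
    rcases d with _ | d
    · simp [hn]
    have e2 := pow_sum_div_card_le_sum_pow (s := (univ : Finset V))
      (f := fun v => (#{b | P v b} : ℝ)) (fun v _ => by positivity) d
    refine le_trans ?_ e2
    rw [le_div_iff₀ (by simpa using pow_pos hn0 d)]
    calc n * p ^ (d + 1) * N ^ (d + 1) * (#(univ : Finset V) : ℝ) ^ d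
        = (p * n * N) ^ (d + 1) := by rw [card_univ, ← hn]; ring
      _ ≤ _ := by gcongr
  have h2 : ∑ x, (#{S ∈ bad | S ⊆ X x} : ℝ) ≤ n ^ h * β ^ d * N ^ d := by
    have := sum_card_bipartiteAbove_eq_sum_card_bipartiteBelow
        (s := bad) (t := (univ : Finset (Fin d → B))) (fun S x => S ⊆ X x)
    simp only [bipartiteAbove, bipartiteBelow] at this
    rw [← Nat.cast_sum, ← this, Nat.cast_sum]
    have hb : (#bad : ℝ) ≤ n ^ h := by
      have : #bad ≤ Fintype.card V ^ h := by
        calc #bad ≤ #(powersetCard h (univ : Finset V)) := card_filter_le _ _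
          _ = (Fintype.card V).choose h := by rw [card_powersetCard, card_univ]
          _ ≤ _ := Nat.choose_le_pow _ _
      rw [hn]; exact_mod_cast this
    calc ∑ S ∈ bad, (#{x | S ⊆ X x} : ℝ) ≤ ∑ S ∈ bad, (β * N) ^ d := by
          refine sum_le_sum fun S hS => ?_
          have (x : Fin d → B) : S ⊆ X x ↔ ∀ i, ∀ v ∈ S, P v (x i) := by
            simp only [X, subset_iff, mem_filter, mem_univ, true_and]
            exact ⟨fun H i v hv => H hv i, fun H v hv i => H i v hv⟩
          simp_rw [this]
          rw [hcount (fun b => ∀ v ∈ S, P v b)]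
          push_cast
          gcongr
          exact (mem_filter.1 hS).2.le
      _ = #bad * (β * N) ^ d := by rw [sum_const, nsmul_eq_mul]
      _ ≤ n ^ h * (β * N) ^ d := by gcongr
      _ = _ := by ring
  obtain ⟨x, hx⟩ : ∃ x, M ≤ (#(X x) : ℝ) - #{S ∈ bad | S ⊆ X x} := by
    by_contra! hc
    have : Nonempty B := Fintype.card_pos_iff.1 hB
    have : ∑ x, ((#(X x) : ℝ) - #{S ∈ bad | S ⊆ X x}) < ∑ _x : Fin d → B, M :=
      sum_lt_sum_of_nonempty univ_nonempty fun x _ => hc x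
    rw [sum_sub_distrib, sum_const, nsmul_eq_mul, card_univ, Fintype.card_fun,
      Fintype.card_fin] at this
    push_cast at this
    rw [← hN] at this
    have h3 := mul_le_mul_of_nonneg_left hM (pow_pos hN0 d).le
    nlinarith
  have hne : ∀ S ∈ bad, ∃ v, v ∈ S := by
    intro S hS
    have := (mem_powersetCard.1 (mem_filter.1 hS).1).2
    exact card_pos.1 (by omega)
  have : Nonempty V := Fintype.card_pos_iff.1 hV
  choose! c hc using hne
  -- Deleting one vertex `c S` from each bad set inside `X x` destroys them all.
  refine ⟨X x \ ({S ∈ bad | S ⊆ X x}.image c), ?_, ?_⟩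
  · refine hx.trans ?_
    have e1 := le_card_sdiff ({S ∈ bad | S ⊆ X x}.image c) (X x)
    have e2 := card_image_le (s := {S ∈ bad | S ⊆ X x}) (f := c)
    have : #(X x) ≤ #(X x \ ({S ∈ bad | S ⊆ X x}.image c)) + #{S ∈ bad | S ⊆ X x} := by omega
    have : (#(X x) : ℝ) ≤
      #(X x \ ({S ∈ bad | S ⊆ X x}.image c)) + #{S ∈ bad | S ⊆ X x} := by exact_mod_cast this
    linarith
  · intro S hS hSh
    by_contra! hlt
    have hSb : S ∈ bad := mem_filter.2 ⟨mem_powersetCard.2 ⟨subset_univ _, hSh⟩, hlt⟩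
    have := hS (hc S hSb)
    rw [Finset.mem_sdiff] at this
    exact this.2 (mem_image_of_mem c (mem_filter.2 ⟨hSb, hS.trans sdiff_subset⟩))

/-! ### Counting and blowing up clique tuples -/

open Classical in
/-- The `k`-tuples of pairwise adjacent vertices inside `W`. -/
noncomputable def cliqueTuples {V : Type*} [Fintype V] (G : SimpleGraph V) (k : ℕ)
    (W : Finset V) : Finset (Fin k → V) :=
  {T | (∀ i, T i ∈ W) ∧ ∀ i j, i ≠ j → G.Adj (T i) (T j)}

open Classical in
lemma cons_mem_cliqueTuples {V : Type*} [Fintype V] {G : SimpleGraph V} {k : ℕ} {W : Finset V}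
    {v : V} {T : Fin k → V} :
    (Fin.cons v T : Fin (k + 1) → V) ∈ cliqueTuples G (k + 1) W ↔
      v ∈ W ∧ T ∈ cliqueTuples G k {w ∈ W | G.Adj v w} := by
  simp only [cliqueTuples, mem_filter, mem_univ, true_and, Fin.forall_fin_succ, Fin.cons_zero,
    Fin.cons_succ, ne_eq, not_true_eq_false, false_imp_iff, Fin.succ_ne_zero, not_false_eq_true,
    true_imp_iff, Fin.succ_inj, (Fin.succ_ne_zero _).symm]
  constructor
  · rintro ⟨⟨h1, h2⟩, h3, h4⟩
    exact ⟨h1, fun i => ⟨h2 i, h3 i⟩, fun i => (h4 i).2⟩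
  · rintro ⟨h1, h2, h3⟩
    exact ⟨⟨h1, fun i => (h2 i).1⟩, fun i => (h2 i).2, fun i => ⟨(h2 i).2.symm, h3 i⟩⟩

-- Splitting off the first vertex turns the count into the edge count of a bipartite relation
-- between vertices and `k`-tuples, as dependent random choice requires.
open Classical in
lemma card_cliqueTuples_succ {V : Type*} [Fintype V] (G : SimpleGraph V) (k : ℕ)
    (W : Finset V) :
    #(cliqueTuples G (k + 1) W) =
      ∑ v, #{T : Fin k → V | (Fin.cons v T : Fin (k + 1) → V) ∈ cliqueTuples G (k + 1) W} := by
  rw [← card_sigma]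
  refine card_bij' (fun T _ => ⟨T 0, Fin.tail T⟩) (fun x _ => Fin.cons x.1 x.2) ?_ ?_ ?_ ?_
  · intro T hT; simpa [Fin.cons_self_tail] using hT
  · intro x hx; simpa using hx
  · intro T _; simp
  · intro x _; simp

open Classical in
lemma card_cliqueTuples_succ' {V : Type*} [Fintype V] (G : SimpleGraph V) (k : ℕ)
    (W : Finset V) :
    #(cliqueTuples G (k + 1) W) = ∑ v ∈ W, #(cliqueTuples G k {w ∈ W | G.Adj v w}) := by
  rw [card_cliqueTuples_succ, ← sum_subset (subset_univ W)]
  · refine sum_congr rfl fun v hv => congrArg card ?_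
    ext T
    simp [cons_mem_cliqueTuples, hv]
  · intro v _ hv
    simp [cons_mem_cliqueTuples, hv]

open Classical in
/-- If every vertex of `W` has few non-neighbours in `W`, then `W` has many clique tuples. -/
lemma pow_le_card_cliqueTuples {V : Type*} [Fintype V] (G : SimpleGraph V) (W : Finset V)
    {x y : ℝ} (hx : 0 ≤ x) (hy : 0 ≤ y) (hW : ∀ v ∈ W, (#{w ∈ W | ¬ G.Adj v w} : ℝ) ≤ x)
    (k : ℕ) (W' : Finset V) (hW' : W' ⊆ W) (hc : k * x + y ≤ #W' + x) :
    y ^ k ≤ #(cliqueTuples G k W') := by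
  induction k generalizing W' with
  | zero => simp [cliqueTuples]
  | succ k ih =>
    push_cast at hc
    rw [card_cliqueTuples_succ']
    have hyW : y ≤ #W' := by
      have : 0 ≤ (k : ℝ) * x := by positivity
      linarith
    -- `hc` says #W' ≥ k x + y; restricting to the neighbours of `v` loses at most x vertices, so
    -- the hypothesis survives with one step fewer.
    have key : ∀ v ∈ W', y ^ k ≤ (#(cliqueTuples G k {w ∈ W' | G.Adj v w}) : ℝ) := by
      intro v hv
      refine ih _ ((filter_subset _ _).trans hW') ?_
      have e1 := card_filter_add_card_filter_not (s := W') (fun w => G.Adj v w)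
      have e2 : (#{w ∈ W' | ¬ G.Adj v w} : ℝ) ≤ x :=
        le_trans (by exact_mod_cast card_le_card (filter_subset_filter _ hW')) (hW v (hW' hv))
      have e3 : (#W' : ℝ) = #{w ∈ W' | G.Adj v w} + #{w ∈ W' | ¬ G.Adj v w} := by
        exact_mod_cast e1.symm
      linarith
    push_cast
    calc y ^ (k + 1) = y * y ^ k := by ring
      _ ≤ #W' * y ^ k := by gcongr
      _ = ∑ v ∈ W', y ^ k := by rw [sum_const, nsmul_eq_mul]
      _ ≤ _ := sum_le_sum key

open Classical in
/-- If `G` has at least `n ^ (k - γ)` tuples of `k` pairwise adjacent vertices in `W`, and every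
set of `n ^ (1 - δ)` vertices contains a clique of size `h`, then `W` contains a clique of
size `k * h`. -/
lemma exists_isNClique_of_cliqueTuples {h : ℕ} (hh : 0 < h) {δ : ℝ} (hδ : 0 < δ) (hδ1 : δ ≤ 1)
    (k : ℕ) :
    ∃ γ : ℝ, 0 < γ ∧ ∀ᶠ n : ℕ in atTop, ∀ G : SimpleGraph (Fin n),
      (∀ U : Finset (Fin n), (n : ℝ) ^ (1 - δ) ≤ #U → ∃ S ⊆ U, G.IsNClique h S) →
      ∀ W : Finset (Fin n), (n : ℝ) ^ ((k : ℝ) - γ) ≤ #(cliqueTuples G k W) →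
      ∃ S ⊆ W, G.IsNClique (k * h) S := by
  induction k with
  | zero =>
    refine ⟨1, one_pos, Eventually.of_forall fun n G _ W _ => ⟨∅, empty_subset _, ?_⟩⟩
    simp [isNClique_iff]
  | succ k ih =>
    obtain ⟨γ', hγ', hn'⟩ := ih
    -- Large enough that the bad-set term n^h n^(-γ' d) is at most 1; the `+ 1` keeps `d` positive.
    obtain ⟨d, hd⟩ := exists_nat_ge (h / γ' + 1)
    have hdh : (h : ℝ) ≤ γ' * d := by
      have : (h : ℝ) / γ' ≤ d := by linarith
      rwa [div_le_iff₀' hγ'] at this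
    have hd0 : (0 : ℝ) < d := by
      have : 0 ≤ (h : ℝ) / γ' := by positivity
      linarith
    have hlarge : ∀ᶠ n : ℕ in atTop, (2 : ℝ) ≤ (n : ℝ) ^ (δ / 2) :=
      ((tendsto_rpow_atTop (by positivity : 0 < δ / 2)).comp
        tendsto_natCast_atTop_atTop).eventually_ge_atTop 2
    -- With p = n^(-δ/(2d)), n p^d = n^(1 - δ/2) ≥ 2 n^(1 - δ), which leaves room to subtract 1.
    refine ⟨δ / (2 * d), by positivity, ?_⟩
    filter_upwards [hn', hlarge, eventually_ge_atTop 1] with n hn hl hn1 G hG W hW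
    have hn0 : (0 : ℝ) < n := by exact_mod_cast hn1
    have hn1' : (1 : ℝ) ≤ n := by exact_mod_cast hn1
    obtain ⟨U, hU, hUS⟩ := dependent_random_choice (V := Fin n) (B := Fin k → Fin n)
      (fun v T => (Fin.cons v T : Fin (k + 1) → Fin n) ∈ cliqueTuples G (k + 1) W)
      (h := h) (d := d) hh (p := (n : ℝ) ^ (-(δ / (2 * d)))) (β := (n : ℝ) ^ (-γ'))
      (M := (n : ℝ) ^ (1 - δ)) (by positivity) (by positivity)
      (by rwa [Fintype.card_fin]) (Fintype.card_pos_iff.2 ⟨fun _ => ⟨0, hn1⟩⟩) (by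
        refine le_trans (le_of_eq ?_) (hW.trans (le_of_eq ?_))
        rotate_left
        · rw [card_cliqueTuples_succ, Nat.cast_sum]
          exact sum_congr rfl fun v _ => by congr
        simp only [Fintype.card_fun, Fintype.card_fin]
        push_cast
        rw [mul_assoc, ← pow_succ', ← Real.rpow_natCast, ← Real.rpow_add hn0]
        congr 1
        push_cast
        ring) (by
        simp only [Fintype.card_fin]
        have e1 : (n : ℝ) * ((n : ℝ) ^ (-(δ / (2 * d)))) ^ d
            = (n : ℝ) ^ (1 - δ) * (n : ℝ) ^ (δ / 2) := by
          rw [← Real.rpow_natCast, ← Real.rpow_mul hn0.le, ← Real.rpow_add hn0,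
            ← Real.rpow_one_add' hn0.le]
          · congr 1
            field_simp
            ring
          · have : -(δ / (2 * d)) * (d : ℝ) = -(δ / 2) := by field_simp
            rw [this]; linarith
        have e2 : (n : ℝ) ^ h * ((n : ℝ) ^ (-γ')) ^ d ≤ 1 := by
          rw [← Real.rpow_natCast, ← Real.rpow_natCast, ← Real.rpow_mul hn0.le,
            ← Real.rpow_add hn0]
          exact Real.rpow_le_one_of_one_le_of_nonpos hn1' (by linarith)
        have e3 : 1 ≤ (n : ℝ) ^ (1 - δ) := Real.one_le_rpow hn1' (by linarith)
        rw [e1]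
        nlinarith)
    obtain ⟨A, hAU, hA⟩ := hG U hU
    have hT := hUS A hAU hA.card_eq
    simp only [cons_mem_cliqueTuples] at hT
    have hA0 : A.Nonempty := card_pos.1 (by rw [hA.card_eq]; exact hh)
    obtain ⟨a, ha⟩ := hA0
    have hAW : A ⊆ W := by
      have hpos : 0 < (#{T : Fin k → Fin n | ∀ v ∈ A, v ∈ W ∧
          T ∈ cliqueTuples G k {w ∈ W | G.Adj v w}} : ℝ) := by
        refine lt_of_lt_of_le ?_ hT
        simp only [Fintype.card_fun, Fintype.card_fin]
        positivity
      obtain ⟨T, hT'⟩ := card_pos.1 (Nat.cast_pos.1 hpos)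
      exact fun v hv => ((mem_filter.1 hT').2 v hv).1
    -- The many `k`-tuples common to all of `A` are clique tuples in the common neighbourhood of
    -- `A`, so induction applies there.
    obtain ⟨S, hSW, hS⟩ := hn G hG {w ∈ W | ∀ v ∈ A, G.Adj v w} (by
      calc (n : ℝ) ^ ((k : ℝ) - γ')
          = (n : ℝ) ^ (-γ') * (Fintype.card (Fin k → Fin n) : ℝ) := by
            simp only [Fintype.card_fun, Fintype.card_fin]
            push_cast
            rw [← Real.rpow_natCast, ← Real.rpow_add hn0]
            congr 1
            ring
        _ ≤ _ := hT
        _ ≤ _ := by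
          refine Nat.cast_le.2 (card_le_card fun T hT' => ?_)
          have hT' := (mem_filter.1 hT').2
          simp only [cliqueTuples, mem_filter, mem_univ, true_and] at hT' ⊢
          exact ⟨fun i => ⟨((hT' a ha).2.1 i).1, fun v hv => ((hT' v hv).2.1 i).2⟩,
            (hT' a ha).2.2⟩)
    have hadj : ∀ v ∈ A, ∀ w ∈ S, G.Adj v w := fun v hv w hw => (mem_filter.1 (hSW hw)).2 v hv
    refine ⟨A ∪ S, union_subset hAW (hSW.trans (filter_subset _ _)), ?_, ?_⟩
    · rw [coe_union, SimpleGraph.IsClique, Set.pairwise_union]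
      exact ⟨hA.isClique, hS.isClique, fun v hv w hw _ => ⟨hadj v hv w hw, (hadj v hv w hw).symm⟩⟩
    · rw [card_union_of_disjoint, hA.card_eq, hS.card_eq]
      · ring
      · exact disjoint_left.2 fun v hv hv' => G.irrefl (hadj v hv v hv')

/-! ### Passing to large minimum degree -/

open Classical in
/-- A graph with at least `(κ + ε) n² / 2` edges has a set `W` with `ε n² ≤ #W²` that induces a
subgraph of minimum degree at least `κ * #W - κ / 2`. -/
lemma exists_large_minDegree {V : Type*} [Fintype V] (G : SimpleGraph V) {κ ε : ℝ} (hκ : 0 ≤ κ)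
    (hE : (κ + ε) * (Fintype.card V : ℝ) ^ 2 ≤ 2 * G.edgeSet.ncard) :
    ∃ W : Finset V, ε * (Fintype.card V : ℝ) ^ 2 ≤ (#W : ℝ) ^ 2 ∧
      ∀ v ∈ W, (#{w ∈ W | ¬ G.Adj v w} : ℝ) ≤ (1 - κ) * #W + κ / 2 := by
  let D : Finset V → ℝ := fun W => ∑ v ∈ W, ∑ w ∈ W, if G.Adj v w then (1 : ℝ) else 0
  have hD : D univ = 2 * G.edgeSet.ncard := by
    have := G.sum_degrees_eq_twice_card_edges
    rw [← coe_edgeFinset, Set.ncard_coe_finset]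
    simp only [D]
    rw [show (2 : ℝ) * (#G.edgeFinset : ℝ) = ((2 * #G.edgeFinset : ℕ) : ℝ) by push_cast; ring,
      ← this]
    push_cast
    refine sum_congr rfl fun v _ => ?_
    rw [← card_neighborFinset_eq_degree, neighborFinset_eq_filter, sum_boole]
  have hdeg : ∀ v W, (∑ w ∈ W, if G.Adj v w then (1 : ℝ) else 0) = #{w ∈ W | G.Adj v w} :=
    fun v W => by rw [sum_boole]
  -- `D W` is twice the number of edges inside `W`. Comparing the maximiser with `univ` bounds its
  -- size; comparing it with `W.erase v` bounds the degree of `v`.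
  obtain ⟨W, -, hW⟩ := exists_max_image (univ : Finset (Finset V))
    (fun W => D W - κ * (#W : ℝ) ^ 2) univ_nonempty
  refine ⟨W, ?_, fun v hv => ?_⟩
  · have h1 := hW univ (mem_univ _)
    rw [hD, card_univ] at h1
    have h2 : D W ≤ (#W : ℝ) ^ 2 := by
      calc D W ≤ ∑ v ∈ W, ∑ w ∈ W, (1 : ℝ) := by
            refine sum_le_sum fun v _ => sum_le_sum fun w _ => ?_
            split_ifs <;> norm_num
        _ = _ := by simp [sq]
    nlinarith [mul_nonneg hκ (sq_nonneg (#W : ℝ))]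
  · have h1 := hW (W.erase v) (mem_univ _)
    have h2 : D W = D (W.erase v) + 2 * #{w ∈ W | G.Adj v w} := by
      simp only [D]
      rw [← add_sum_erase W _ hv, hdeg v W]
      have : ∑ x ∈ W.erase v, ∑ w ∈ W, (if G.Adj x w then (1 : ℝ) else 0) =
          ∑ x ∈ W.erase v, ((if G.Adj v x then (1 : ℝ) else 0) +
            ∑ w ∈ W.erase v, if G.Adj x w then (1 : ℝ) else 0) := by
        refine sum_congr rfl fun x _ => ?_
        rw [← add_sum_erase W _ hv]
        simp only [G.adj_comm x v]
      rw [this, sum_add_distrib]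
      have e : ∑ x ∈ W.erase v, (if G.Adj v x then (1 : ℝ) else 0) = #{w ∈ W | G.Adj v w} := by
        rw [← hdeg v W, ← add_sum_erase W _ hv]
        simp
      rw [e]; ring
    have h3 : (#(W.erase v) : ℝ) = #W - 1 := by
      rw [card_erase_of_mem hv, Nat.cast_sub (card_pos.2 ⟨v, hv⟩)]; simp
    have h4 : (#W : ℝ) = #{w ∈ W | G.Adj v w} + #{w ∈ W | ¬ G.Adj v w} := by
      exact_mod_cast (card_filter_add_card_filter_not (s := W) (fun w => G.Adj v w)).symm
    rw [h3, h2] at h1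
    nlinarith

/-! ### The upper bound -/

lemma free_top_iff_cliqueFree {V : Type*} {G : SimpleGraph V} {s : ℕ} :
    (⊤ : SimpleGraph (Fin s)).Free G ↔ G.CliqueFree s := by
  simpa using (cliqueFree_iff_top_free (G := G) (β := Fin s)).symm

/-- The factor 2 in the exponent absorbs the `+ 1` in n < (Q + 1)^(t - 1), since z + 1 ≤ z² for z ≥
2. -/
lemma eventually_rpow_le_inverseRamsey {t : ℕ} (ht : 2 ≤ t) :
    ∀ᶠ n : ℕ in atTop, (n : ℝ) ^ (1 / (2 * ((t - 1 : ℕ) : ℝ))) ≤ inverseRamsey t n := by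
  have hh : (0 : ℝ) < ((t - 1 : ℕ) : ℝ) := by
    have : 0 < t - 1 := by omega
    exact_mod_cast this
  have hlarge := ((tendsto_rpow_atTop
    (by positivity : 0 < 1 / (2 * ((t - 1 : ℕ) : ℝ)))).comp
      tendsto_natCast_atTop_atTop).eventually_ge_atTop 2
  filter_upwards [hlarge] with n hn
  simp only [Function.comp_apply] at hn
  have h1 := lt_inverseRamsey_succ_pow ht n
  set z := (n : ℝ) ^ (1 / (2 * ((t - 1 : ℕ) : ℝ))) with hz
  have hz' : (z ^ 2) ^ (t - 1) = n := by
    rw [← pow_mul, hz, ← Real.rpow_natCast, ← Real.rpow_mul (by positivity)]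
    push_cast
    rw [one_div_mul_cancel (by positivity), Real.rpow_one]
  by_contra! hlt
  have h2 : ((inverseRamsey t n : ℝ) + 1) ^ (t - 1) ≤ (z ^ 2) ^ (t - 1) := by
    gcongr
    nlinarith
  rw [hz'] at h2
  exact absurd h1 (not_lt.2 (by exact_mod_cast h2))

lemma tendsto_inverseRamsey {t : ℕ} (ht : 2 ≤ t) :
    Tendsto (inverseRamsey t) atTop atTop := by
  have hh : (0 : ℝ) < ((t - 1 : ℕ) : ℝ) := by
    have : 0 < t - 1 := by omega
    exact_mod_cast this
  exact tendsto_natCast_atTop_iff.1 (tendsto_atTop_mono' _ (eventually_rpow_le_inverseRamsey ht)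
    ((tendsto_rpow_atTop (by positivity)).comp tendsto_natCast_atTop_atTop))

/-- Under the Ramsey gap, in a graph with independence number less than `Q(t, n)` every set of
`n ^ (1 - δ)` vertices contains a `(t - 1)`-clique. -/
lemma RamseyGap.eventually_exists_isNClique {t : ℕ} (ht : 2 ≤ t) (hgap : RamseyGap t) :
    ∃ δ : ℝ, 0 < δ ∧ δ ≤ 1 ∧ ∀ᶠ n : ℕ in atTop, ∀ G : SimpleGraph (Fin n),
      G.indepNum < inverseRamsey t n →
      ∀ U : Finset (Fin n), (n : ℝ) ^ (1 - δ) ≤ #U → ∃ S ⊆ U, G.IsNClique (t - 1) S := by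
  obtain ⟨ϑ, hϑ, N, hN⟩ := hgap
  have hh : (0 : ℝ) < ((t - 1 : ℕ) : ℝ) := by
    have : 0 < t - 1 := by omega
    exact_mod_cast this
  -- Chosen so that n^δ ≤ Q^ϑ.
  refine ⟨min 1 (ϑ / (2 * ((t - 1 : ℕ) : ℝ))), by positivity, min_le_left _ _, ?_⟩
  filter_upwards [eventually_rpow_le_inverseRamsey ht, eventually_ge_atTop 1,
    (tendsto_inverseRamsey ht).eventually_gt_atTop N] with n hq hn1 hqN G hG U hU
  have hn0 : (0 : ℝ) < n := by exact_mod_cast hn1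
  have hn1' : (1 : ℝ) ≤ n := by exact_mod_cast hn1
  set δ := min 1 (ϑ / (2 * ((t - 1 : ℕ) : ℝ)))
  have h1 : (n : ℝ) ^ δ ≤ (inverseRamsey t n : ℝ) ^ ϑ :=
    calc (n : ℝ) ^ δ ≤ (n : ℝ) ^ (ϑ / (2 * ((t - 1 : ℕ) : ℝ))) :=
          Real.rpow_le_rpow_of_exponent_le hn1' (min_le_right _ _)
      _ = ((n : ℝ) ^ (1 / (2 * ((t - 1 : ℕ) : ℝ)))) ^ ϑ := by
          rw [← Real.rpow_mul hn0.le]; congr 1; ring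
      _ ≤ _ := by gcongr
  have h2 : (ramseyNumber (t - 1) (inverseRamsey t n) : ℝ) ≤ #U :=
    calc (ramseyNumber (t - 1) (inverseRamsey t n) : ℝ)
        ≤ ramseyNumber t (inverseRamsey t n) / (inverseRamsey t n : ℝ) ^ ϑ := hN _ hqN
      _ ≤ n / (n : ℝ) ^ δ := by
          gcongr
          exact ramseyNumber_inverseRamsey_le t n
      _ = (n : ℝ) ^ (1 - δ) := by rw [Real.rpow_sub hn0, Real.rpow_one]
      _ ≤ _ := hU
  rcases (isRamsey_ramseyNumber (ℓ := t - 1) (by omega) _).exists_subset G U (by exact_mod_cast h2) with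
    h3 | ⟨S, -, hS⟩
  · exact h3
  · have := hS.isIndepSet.card_le_indepNum
    rw [hS.card_eq] at this
    omega

lemma RamseyGap.eventually_rtNumber_le {s t r : ℕ} (ht : 2 ≤ t) (hr0 : 0 < r)
    (hs : s ≤ (r + 1) * (t - 1)) (hgap : RamseyGap t) {ε : ℝ} (hε : 0 < ε) :
    ∀ᶠ n : ℕ in atTop, (rtNumber n (⊤ : SimpleGraph (Fin s)) (inverseRamsey t n : ℝ) : ℝ) ≤
      (1 / 2 * (1 - 1 / (r : ℝ)) + ε) * (n : ℝ) ^ 2 := by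
  classical
  obtain ⟨δ, hδ, hδ1, hcl⟩ := hgap.eventually_exists_isNClique ht
  obtain ⟨γ, hγ, hit⟩ := exists_isNClique_of_cliqueTuples (h := t - 1) (by omega) hδ hδ1 (r + 1)
  have hr1 : (1 : ℝ) ≤ r := by exact_mod_cast hr0
  -- One ε goes into the minimum degree, a second one (`κ + ε` below) into the size of `W`.
  obtain ⟨κ, hκ⟩ : ∃ κ : ℝ, κ = 1 - 1 / (r : ℝ) + ε := ⟨_, rfl⟩
  have hrκ : r * (1 - κ) = 1 - r * ε := by rw [hκ]; field_simp; ring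
  have hκ0 : 0 ≤ κ := by
    have : 1 / (r : ℝ) ≤ 1 := by rw [div_le_one (by linarith)]; exact hr1
    linarith
  -- As #W ≥ √ε n, the degree surplus ε #W is at least 2 c n; half of it pays for the error κ/2, the
  -- other half is the `y` of the clique count.
  obtain ⟨c, hc⟩ : ∃ c : ℝ, c = ε * √ε / 2 := ⟨_, rfl⟩
  have hc0 : 0 < c := by rw [hc]; positivity
  have hl1 : ∀ᶠ n : ℕ in atTop, κ ≤ 2 * c * n :=
    (tendsto_natCast_atTop_atTop.const_mul_atTop (by positivity : 0 < 2 * c)).eventually_ge_atTop κ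
  have hl2 : ∀ᶠ n : ℕ in atTop, (c ^ (r + 1))⁻¹ ≤ (n : ℝ) ^ γ :=
    ((tendsto_rpow_atTop hγ).comp tendsto_natCast_atTop_atTop).eventually_ge_atTop _
  filter_upwards [hcl, hit, hl1, hl2, eventually_ge_atTop 1] with n hcl hit hl1 hl2 hn1
  have hn0 : (0 : ℝ) < n := by exact_mod_cast hn1
  have main : ∀ G : SimpleGraph (Fin n), G.CliqueFree s → G.indepNum < inverseRamsey t n →
      2 * (G.edgeSet.ncard : ℝ) ≤ (κ + ε) * (n : ℝ) ^ 2 := by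
    intro G hGs hGi
    by_contra! hlt
    obtain ⟨W, hW1, hW2⟩ := exists_large_minDegree G (κ := κ) (ε := ε) hκ0
      (by rw [Fintype.card_fin]; exact hlt.le)
    rw [Fintype.card_fin] at hW1
    have hw : √ε * n ≤ #W := by
      refine le_of_sq_le_sq ?_ (by positivity)
      rw [mul_pow, Real.sq_sqrt hε.le]
      exact hW1
    have hw' : 2 * c * n ≤ ε * #W := by
      calc 2 * c * n = ε * (√ε * n) := by rw [hc]; ring
        _ ≤ _ := by gcongr
    have hW0 : W.Nonempty := by
      rw [← card_pos]
      have : 0 < √ε * n := by positivity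
      exact_mod_cast this.trans_le hw
    obtain ⟨v, hv⟩ := hW0
    have hx : 0 ≤ (1 - κ) * #W + κ / 2 := le_trans (by positivity) (hW2 v hv)
    have hcount := pow_le_card_cliqueTuples G W hx (y := c * n) (by positivity)
      hW2 (r + 1) W subset_rfl (by
        push_cast
        have : (r : ℝ) * ((1 - κ) * #W + κ / 2) = #W - r * (ε * #W - κ / 2) := by
          linear_combination (#W : ℝ) * hrκ
        have : 1 * (ε * #W - κ / 2) ≤ r * (ε * #W - κ / 2) := by
          gcongr
          linarith
        linarith)
    obtain ⟨S, -, hS⟩ := hit G (hcl G hGi) W (by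
      refine le_trans ?_ hcount
      rw [Real.rpow_sub hn0, Real.rpow_natCast, div_le_iff₀ (by positivity)]
      calc (n : ℝ) ^ (r + 1) = (c * n) ^ (r + 1) * (c ^ (r + 1))⁻¹ := by
            rw [mul_pow]; field_simp
        _ ≤ _ := by gcongr)
    exact hGs.mono hs S hS
  have hb : ∀ e ∈ {e : ℕ | ∃ G : SimpleGraph (Fin n), (⊤ : SimpleGraph (Fin s)).Free G ∧
      (G.indepNum : ℝ) < (inverseRamsey t n : ℝ) ∧ G.edgeSet.ncard = e},
      (e : ℝ) ≤ (1 / 2 * (1 - 1 / (r : ℝ)) + ε) * (n : ℝ) ^ 2 := by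
    rintro e ⟨G, hG, hGi, rfl⟩
    have := main G (free_top_iff_cliqueFree.1 hG) (by exact_mod_cast hGi)
    rw [hκ] at this
    linarith
  rw [rtNumber]
  rcases Set.eq_empty_or_nonempty {e : ℕ | ∃ G : SimpleGraph (Fin n),
      (⊤ : SimpleGraph (Fin s)).Free G ∧ (G.indepNum : ℝ) < (inverseRamsey t n : ℝ) ∧
      G.edgeSet.ncard = e} with h0 | h0
  · rw [h0, csSup_empty]
    have : 1 / 2 * (1 - 1 / (r : ℝ)) + ε = (κ + ε) / 2 := by rw [hκ]; ring
    rw [this]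
    simp only [bot_eq_zero', Nat.cast_zero]
    positivity
  · refine hb _ (Nat.sSup_mem h0 ?_)
    obtain ⟨M, hM⟩ := exists_nat_ge ((1 / 2 * (1 - 1 / (r : ℝ)) + ε) * (n : ℝ) ^ 2)
    exact ⟨M, fun e he => by exact_mod_cast (hb e he).trans hM⟩

/-! ### The lower bound -/

lemma ncard_edgeSet_le_rtNumber {V : Type*} {n : ℕ} {H : SimpleGraph V} {x : ℝ}
    (G : SimpleGraph (Fin n)) (hG : H.Free G) (hx : (G.indepNum : ℝ) < x) :
    G.edgeSet.ncard ≤ rtNumber n H x := by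
  refine le_csSup ⟨(Set.univ : Set (Sym2 (Fin n))).ncard, ?_⟩ ⟨G, hG, hx, rfl⟩
  rintro e ⟨G', -, -, rfl⟩
  exact Set.ncard_le_ncard (Set.subset_univ _) Set.finite_univ

/-- Vertices with different colours are joined, and those of the same colour are joined if their
positions are adjacent in `G₀`. -/
def layeredGraph {V C P : Type*} (c : V → C) (p : V → P) (G₀ : SimpleGraph P) :
    SimpleGraph V where
  Adj v w := c v ≠ c w ∨ (c v = c w ∧ G₀.Adj (p v) (p w))
  symm := ⟨fun _ _ h => h.imp Ne.symm fun h => ⟨h.1.symm, h.2.symm⟩⟩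
  loopless := ⟨fun _ h => h.elim (fun h => h rfl) fun h => G₀.irrefl h.2⟩

section layeredGraph

variable {V C P : Type*} {c : V → C} {p : V → P} {G₀ : SimpleGraph P}

/-- By pigeonhole a clique on `s` vertices has `t` of one colour, and their positions form a clique
in `G₀`. -/
lemma layeredGraph_cliqueFree [Fintype C] {s t : ℕ}
    (hinj : ∀ v w, c v = c w → p v = p w → v = w) (hG₀ : G₀.CliqueFree t)
    (hs : Fintype.card C * (t - 1) < s) : (layeredGraph c p G₀).CliqueFree s := by
  classical
  intro S hS
  obtain ⟨a, -, ha⟩ := exists_lt_card_fiber_of_mul_lt_card_of_maps_to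
    (s := S) (t := (univ : Finset C)) (f := c) (n := t - 1) (fun _ _ => mem_univ _)
    (by rwa [hS.card_eq, card_univ])
  have hc : ∀ v ∈ ({v ∈ S | c v = a} : Finset V), v ∈ S ∧ c v = a := fun v hv => by
    simpa using hv
  refine hG₀.mono (by omega : t ≤ #{v ∈ S | c v = a}) (image p {v ∈ S | c v = a}) ⟨?_, ?_⟩
  · intro x hx y hy hxy
    obtain ⟨v, hv, rfl⟩ := Finset.mem_image.1 (mem_coe.1 hx)
    obtain ⟨w, hw, rfl⟩ := Finset.mem_image.1 (mem_coe.1 hy)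
    rcases hS.isClique (hc v hv).1 (hc w hw).1 (fun e => hxy (by rw [e])) with h | h
    · exact absurd ((hc v hv).2.trans (hc w hw).2.symm) h
    · exact h.2
  · exact card_image_of_injOn fun v hv w hw h =>
      hinj v w ((hc v hv).2.trans (hc w hw).2.symm) h

lemma layeredGraph_indepNum_le [Finite V] [Finite P]
    (hinj : ∀ v w, c v = c w → p v = p w → v = w) :
    (layeredGraph c p G₀).indepNum ≤ G₀.indepNum := by
  classical
  obtain ⟨S, hS⟩ := (layeredGraph c p G₀).exists_isNIndepSet_indepNum
  have hc : ∀ v ∈ S, ∀ w ∈ S, c v = c w := by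
    intro v hv w hw
    by_contra h
    exact hS.isIndepSet hv hw (fun e => h (by rw [e])) (Or.inl h)
  rw [← hS.card_eq, ← card_image_of_injOn (f := p) (s := S)
    fun v hv w hw h => hinj v w (hc v hv w hw) h]
  refine IsIndepSet.card_le_indepNum ?_
  intro x hx y hy hxy hadj
  obtain ⟨v, hv, rfl⟩ := Finset.mem_image.1 (mem_coe.1 hx)
  obtain ⟨w, hw, rfl⟩ := Finset.mem_image.1 (mem_coe.1 hy)
  exact hS.isIndepSet hv hw (fun e => hxy (by rw [e])) (Or.inr ⟨hc v hv w hw, hadj⟩)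

lemma layeredGraph_ncard_edgeSet [Fintype V] [Fintype P]
    (hinj : ∀ v w, c v = c w → p v = p w → v = w) :
    Fintype.card V * (Fintype.card V - Fintype.card P) ≤
      2 * (layeredGraph c p G₀).edgeSet.ncard := by
  classical
  rw [← coe_edgeFinset, Set.ncard_coe_finset, ← sum_degrees_eq_twice_card_edges]
  have hdeg : ∀ v, Fintype.card V - Fintype.card P ≤ (layeredGraph c p G₀).degree v := by
    intro v
    have h1 : #{w | c w = c v} ≤ Fintype.card P := by
      rw [← card_univ]
      refine card_le_card_of_injOn p (fun _ _ => mem_coe.2 (mem_univ _)) fun w hw w' hw' h => ?_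
      have e1 : c w = c v := by simpa using hw
      have e2 : c w' = c v := by simpa using hw'
      exact hinj w w' (e1.trans e2.symm) h
    have h2 := card_filter_add_card_filter_not (s := (univ : Finset V)) (fun w => c w = c v)
    have h3 : #{w | ¬ c w = c v} ≤ (layeredGraph c p G₀).degree v := by
      rw [← card_neighborFinset_eq_degree]
      refine card_le_card fun w hw => ?_
      rw [mem_neighborFinset]
      exact Or.inl (Ne.symm (by simpa using hw))
    rw [card_univ] at h2
    omega
  calc Fintype.card V * (Fintype.card V - Fintype.card P)
      = ∑ _v : V, (Fintype.card V - Fintype.card P) := by simp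
    _ ≤ _ := sum_le_sum fun v _ => hdeg v

end layeredGraph

/-- With a = Q(t, n/r + 1), the recursion and the gap give R(t, a + 1) ≤ n/r + 1 + R(t, a + 1)/4, so
R(t, a + 1) ≤ (4/3)(n/2 + 1) ≤ n for n ≥ 4. -/
lemma RamseyGap.eventually_inverseRamsey_lt {t r : ℕ} (ht : 2 ≤ t) (hr : 2 ≤ r)
    (hgap : RamseyGap t) :
    ∀ᶠ n : ℕ in atTop, inverseRamsey t (n / r + 1) < inverseRamsey t n := by
  obtain ⟨ϑ, hϑ, N, hN⟩ := hgap
  have hdiv : Tendsto (fun n : ℕ => n / r + 1) atTop atTop :=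
    (tendsto_add_atTop_nat 1).comp (Nat.tendsto_div_const_atTop (by omega))
  have hq := (tendsto_add_atTop_nat 1).comp ((tendsto_inverseRamsey ht).comp hdiv)
  have hq4 := ((tendsto_rpow_atTop hϑ).comp
    (tendsto_natCast_atTop_atTop.comp hq)).eventually_ge_atTop 4
  filter_upwards [hq.eventually_gt_atTop N, hq4, eventually_ge_atTop 4] with n h1 h2 hn
  simp only [Function.comp_apply] at h1 h2
  have h3 := ramseyNumber_inverseRamsey_le t (n / r + 1)
  set a := inverseRamsey t (n / r + 1)
  refine le_inverseRamsey ht ?_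
  have h4 := ramseyNumber_succ_succ_le (ℓ := t - 1) (by omega) a
  rw [Nat.sub_add_cancel (by omega)] at h4
  have h5 : (ramseyNumber (t - 1) (a + 1) : ℝ) ≤ ramseyNumber t (a + 1) / 4 :=
    (hN _ h1).trans (by gcongr)
  have h6 : 4 * ramseyNumber (t - 1) (a + 1) ≤ ramseyNumber t (a + 1) := by
    rw [le_div_iff₀ (by norm_num)] at h5
    have : (ramseyNumber (t - 1) (a + 1) : ℝ) * 4 ≤ ramseyNumber t (a + 1) := h5
    have : ramseyNumber (t - 1) (a + 1) * 4 ≤ ramseyNumber t (a + 1) := by exact_mod_cast this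
    omega
  have h7 : n / r ≤ n / 2 := Nat.div_le_div_left hr (by norm_num)
  change ramseyNumber t (a + 1) ≤ n
  omega

lemma RamseyGap.eventually_le_rtNumber {s t r : ℕ} (ht : 2 ≤ t) (hr : 2 ≤ r)
    (hs : r * (t - 1) < s) (hgap : RamseyGap t) :
    ∀ᶠ n : ℕ in atTop, 1 / 2 * (1 - 1 / (r : ℝ)) * (n : ℝ) ^ 2 - n ≤
      rtNumber n (⊤ : SimpleGraph (Fin s)) (inverseRamsey t n : ℝ) := by
  filter_upwards [hgap.eventually_inverseRamsey_lt ht hr] with n hn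
  obtain ⟨G₀, hG₀, ha⟩ := exists_graph_inverseRamsey ht (n / r + 1)
  have hr0 : 0 < r := by omega
  -- Residue and quotient modulo `r` determine a vertex, so each class embeds into the vertex set of
  -- `G₀` without divisibility assumptions.
  let c : Fin n → Fin r := fun v => ⟨v % r, Nat.mod_lt _ hr0⟩
  let p : Fin n → Fin (n / r + 1) :=
    fun v => ⟨v / r, Nat.lt_succ_of_le (Nat.div_le_div_right v.2.le)⟩
  have hinj : ∀ v w, c v = c w → p v = p w → v = w := by
    intro v w h1 h2
    simp only [c, p, Fin.mk.injEq] at h1 h2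
    rw [Fin.ext_iff, ← Nat.div_add_mod v r, ← Nat.div_add_mod w r, h1, h2]
  have hfree := layeredGraph_cliqueFree hinj hG₀ (s := s) (by rwa [Fintype.card_fin])
  have hind := layeredGraph_indepNum_le hinj (G₀ := G₀)
  have hedge := layeredGraph_ncard_edgeSet hinj (G₀ := G₀)
  have hle := ncard_edgeSet_le_rtNumber (layeredGraph c p G₀) (free_top_iff_cliqueFree.2 hfree)
    (x := (inverseRamsey t n : ℝ)) (by exact_mod_cast hind.trans_lt (ha ▸ hn))
  rw [Fintype.card_fin, Fintype.card_fin] at hedge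
  have h1 : (n : ℝ) * (n - (n / r + 1)) ≤
      2 * rtNumber n (⊤ : SimpleGraph (Fin s)) (inverseRamsey t n : ℝ) := by
    have e1 : (n : ℝ) - (n / r + 1) ≤ ((n - (n / r + 1) : ℕ) : ℝ) := by
      have f1 : (n : ℝ) ≤ ((n - (n / r + 1) : ℕ) : ℝ) + ((n / r : ℕ) + 1) := by
        exact_mod_cast (by omega : n ≤ (n - (n / r + 1)) + (n / r + 1))
      have f2 : ((n / r : ℕ) : ℝ) ≤ n / r := Nat.cast_div_le
      linarith
    calc (n : ℝ) * (n - (n / r + 1)) ≤ n * ((n - (n / r + 1) : ℕ) : ℝ) := by gcongr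
      _ ≤ 2 * (layeredGraph c p G₀).edgeSet.ncard := by exact_mod_cast hedge
      _ ≤ _ := by gcongr
  have h2 : (n : ℝ) * (n - (n / r + 1)) = (1 - 1 / (r : ℝ)) * (n : ℝ) ^ 2 - n := by ring
  have h3 : (0 : ℝ) ≤ n := by positivity
  linarith

/-! ### The limit -/

lemma RamseyGap.tendsto_rtNumber {s t r : ℕ} (ht : 2 ≤ t) (hr : 0 < r)
    (hs : s ≤ (r + 1) * (t - 1)) (hs' : r * (t - 1) < s) (hgap : RamseyGap t) :
    Tendsto (fun n : ℕ => (rtNumber n (⊤ : SimpleGraph (Fin s)) (inverseRamsey t n : ℝ) : ℝ) /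
      (n : ℝ) ^ 2) atTop (nhds (1 / 2 * (1 - 1 / (r : ℝ)))) := by
  refine tendsto_order.2 ⟨fun a ha => ?_, fun a ha => ?_⟩
  · rcases (by omega : r = 1 ∨ 2 ≤ r) with rfl | hr2
    · refine Eventually.of_forall fun n => lt_of_lt_of_le ha ?_
      norm_num
      positivity
    · have hl : ∀ᶠ n : ℕ in atTop, 1 < (1 / 2 * (1 - 1 / (r : ℝ)) - a) * n :=
        (tendsto_natCast_atTop_atTop.const_mul_atTop (sub_pos.2 ha)).eventually_gt_atTop 1
      filter_upwards [hgap.eventually_le_rtNumber ht hr2 hs', hl, eventually_ge_atTop 1]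
        with n h1 h2 hn
      have hn0 : (0 : ℝ) < n := by exact_mod_cast hn
      rw [lt_div_iff₀ (by positivity)]
      nlinarith
  · filter_upwards [hgap.eventually_rtNumber_le ht hr hs
      (ε := (a - 1 / 2 * (1 - 1 / (r : ℝ))) / 2) (by linarith), eventually_ge_atTop 1] with n h1 hn
    have hn0 : (0 : ℝ) < (n : ℝ) ^ 2 := by
      have : (0 : ℝ) < n := by exact_mod_cast hn
      positivity
    rw [div_lt_iff₀ hn0]
    refine h1.trans_lt ?_
    gcongr
    linarith

end RamseyTuran

theorem mainTheorem9 (s t r : ℕ) (ht : 2 ≤ t) (hts : t ≤ s) (hr : r = (s - 1) / (t - 1))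
    (hgap : RamseyTuran.RamseyGap t) :
    RamseyTuran.HasRTDensity (⊤ : SimpleGraph (Fin s))
      (fun n : ℕ => (RamseyTuran.inverseRamsey t n : ℝ)) (1 / 2 * (1 - 1 / (r : ℝ))) := by
  have ht0 : 0 < t - 1 := by omega
  have h1 : 0 < r := hr ▸ Nat.div_pos (by omega) ht0
  have h2 : s - 1 < (t - 1) * (r + 1) := hr ▸ Nat.lt_mul_div_succ (s - 1) ht0
  have h3 : r * (t - 1) ≤ s - 1 := hr ▸ Nat.div_mul_le_self (s - 1) (t - 1)
  have h := hgap.tendsto_rtNumber (s := s) (r := r) ht h1 (by rw [mul_comm]; omega) (by omega)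
  exact ⟨h.limsup_eq, h.liminf_eq⟩
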